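/- Let $\Lambda_+=\{z\in\mathbb Z+i\mathbb Z:\operatorname{Re} z\ge 0\}$. A function $f:\Lambda_+\to\mathbb C$ is *discrete analytic* on $\Lambda_+$ if $$\frac{f(z+1+i)-f(z)}{1+i}=\frac{f(z+1)-f(z+i)}{1-i},\qquad z\in\Lambda_+ .$$ For such $f$ put $\delta_xf(z)=f(z+1)-f(z)$ and $$Zf(z)=\frac{f(0)-f(z)}2+\int_0^z f\,\delta z,\qquad \int_\gamma f\,\delta z=\sum_{k=1}^n\frac{f(z_{k-1})+f(z_k)}2\,(z_k-z_{k-1}),$$ where $\gamma=(z_0,\dots,z_n)$ is any path in $\Lambda_+$ from $z_0=0$ to $z_n=z$ with $|z_k-z_{k-1}|=1$ for $1\le k\le n$ (the value does not depend on the path); $Zf$ is again discrete analytic. Let $z^{(n)}=(Z^n1)(z)$ and $\hat f(n)=(\delta_x^nf)(0)$ for $n\ge 0$. The Hardy space $\mathbf H_2(\Lambda_+)$ is the Hilbert space of the discrete analytic functions $f(z)=\sum_{n\ge0}\hat f(n)z^{(n)}$ on $\Lambda_+$ with $\sum_n|\hat f(n)|^2<\infty$, with inner product $\langle f,g\rangle=\sum_n\hat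 f(n)\overline{\hat g(n)}$; it is invariant under $Z$. A discrete analytic function $s$ on $\Lambda_+$ is a *discrete analytic Schur function* if $\sum_{n\ge0}|(Z^ns)(z)|^2<\infty$ for all $z\in\Lambda_+$ and the kernel $$K^s_w(z)=\sum_{n=0}^\infty\Bigl(z^{(n)}\overline{w^{(n)}}-(Z^ns)(z)\overline{(Z^ns)(w)}\Bigr)$$ is positive (semidefinite) on $\Lambda_+$. For such $s$, let $M_sf=s\odot f$ for $f\in\mathbf H_2(\Lambda_+)$, where $$(s\odot f)(z)=\sum_{n=0}^\infty\sum_{m=0}^n\hat s(m)\hat f(n-m)\,z^{(n)}.$$ **Theorem (a Beurling-type theorem).** Let $\mathbf H\ne\{0\}$ be a closed subspace of $\mathbf H_2(\Lambda_+)$. Then $\mathbf H$ is $Z$-invariant if and only if there exists a discrete analytic Schur function $s$ such that $M_s$ is an isometry of $\mathbf H_2(\Lambda_+)$ into itself with range $\mathbf H$. -/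

import Mathlib

open scoped ComplexOrder ComplexConjugate

namespace DiscreteAnalytic

noncomputable section

/-- The half-lattice `Λ₊ = {x + i y : x, y ∈ ℤ, 0 ≤ x}`; the pair `(x, y)` stands for the
point `x + i y`. -/
abbrev HalfLattice : Type := ℕ × ℤ

/-- The complex number `x + i y` given by a point of the half-lattice. -/
def toComplex (z : HalfLattice) : ℂ := (z.1 : ℂ) + (z.2 : ℂ) * Complex.I

/-- `f` is discrete analytic on `Λ₊`:
`(f (z + 1 + i) - f z) / (1 + i) = (f (z + 1) - f (z + i)) / (1 - i)` for all `z ∈ Λ₊`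
(the points `z + 1`, `z + i`, `z + 1 + i` then lie in `Λ₊` too). -/
def IsDiscreteAnalytic (f : HalfLattice → ℂ) : Prop :=
  ∀ (x : ℕ) (y : ℤ),
    (f (x + 1, y + 1) - f (x, y)) / (1 + Complex.I) =
      (f (x + 1, y) - f (x, y + 1)) / (1 - Complex.I)

/-- The difference operator `δₓ f (z) = f (z + 1) - f z`. -/
def deltaX : (HalfLattice → ℂ) →ₗ[ℂ] (HalfLattice → ℂ) where
  toFun f := fun z => f (z.1 + 1, z.2) - f z
  map_add' f g := by funext z; simp only [Pi.add_apply]; ring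
  map_smul' c f := by funext z; simp only [Pi.smul_apply, smul_eq_mul, RingHom.id_apply]; ring

/-- The points `γ 0, …, γ n` form a lattice path: consecutive points are at distance one. -/
def IsPath (γ : ℕ → HalfLattice) (n : ℕ) : Prop :=
  ∀ k < n, ‖toComplex (γ (k + 1)) - toComplex (γ k)‖ = 1

/-- The discrete integral of `f` over the path `(γ 0, …, γ n)`. -/
def pathIntegral (f : HalfLattice → ℂ) (γ : ℕ → HalfLattice) (n : ℕ) : ℂ :=
  ∑ k ∈ Finset.range n,
    (f (γ k) + f (γ (k + 1))) / 2 * (toComplex (γ (k + 1)) - toComplex (γ k))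

/-- The lattice path that runs from `0` vertically to `i y`, and then horizontally to the right.
It reaches `x + i y` after `|y| + x` steps. -/
def stdPath (y : ℤ) (k : ℕ) : HalfLattice :=
  (k - y.natAbs, y.sign * (min k y.natAbs : ℕ))

/-- The discrete integral `∫₀ᶻ f δz`, taken along the standard path from `0` to `z`. For a discrete
analytic `f` every other path in `Λ₊` from `0` to `z` gives the same value, see
`pathIntegral_eq_integral`. -/
def integral (f : HalfLattice → ℂ) (z : HalfLattice) : ℂ :=
  pathIntegral f (stdPath z.2) (z.2.natAbs + z.1)

/-- The discrete integration operator `Z f (z) = (f 0 - f z) / 2 + ∫₀ᶻ f δz`. -/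
def opZ : (HalfLattice → ℂ) →ₗ[ℂ] (HalfLattice → ℂ) where
  toFun f := fun z => (f (0, 0) - f z) / 2 + integral f z
  map_add' f g := by
    funext z
    have h : integral (f + g) z = integral f z + integral g z := by
      simp only [integral, pathIntegral, ← Finset.sum_add_distrib, Pi.add_apply]
      exact Finset.sum_congr rfl fun k _ => by ring
    simp only [Pi.add_apply, h]; ring
  map_smul' c f := by
    funext z
    have h : integral (c • f) z = c * integral f z := by
      simp only [integral, pathIntegral, Finset.mul_sum, Pi.smul_apply, smul_eq_mul]
      exact Finset.sum_congr rfl fun k _ => by ring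
    simp only [Pi.smul_apply, smul_eq_mul, RingHom.id_apply, h]; ring

/-- The discrete analytic polynomials `z⁽ⁿ⁾ = Zⁿ 1`. -/
def basisFun (n : ℕ) : HalfLattice → ℂ := (opZ ^ n) 1

/-- The Taylor coefficient `f̂(n) = (δₓⁿ f)(0)`. -/
def coeff (f : HalfLattice → ℂ) (n : ℕ) : ℂ := (deltaX ^ n) f (0, 0)

/-! ### Path integrals of discrete analytic functions -/

theorem stdPath_start (y : ℤ) : stdPath y 0 = (0, 0) := by simp [stdPath]

theorem stdPath_end (x : ℕ) (y : ℤ) : stdPath y (y.natAbs + x) = (x, y) := by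
  simp [stdPath, Int.sign_mul_abs]

theorem toComplex_right (x : ℕ) (y : ℤ) : toComplex (x + 1, y) - toComplex (x, y) = 1 := by
  simp [toComplex]

theorem toComplex_up (x : ℕ) (y : ℤ) :
    toComplex (x, y + 1) - toComplex (x, y) = Complex.I := by
  simp only [toComplex]; push_cast; ring

theorem isPath_stdPath (z : HalfLattice) : IsPath (stdPath z.2) (z.2.natAbs + z.1) := by
  rintro k -
  obtain ⟨x, y⟩ := z
  simp only
  rcases le_or_gt y.natAbs k with h | h
  · obtain ⟨m, rfl⟩ := Nat.exists_eq_add_of_le h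
    rw [add_assoc, stdPath_end, stdPath_end, toComplex_right]; simp
  · have h1 : stdPath y k = (0, y.sign * (k : ℤ)) := by
      ext <;> simp [stdPath, Nat.sub_eq_zero_of_le h.le, min_eq_left h.le]
    have h2 : stdPath y (k + 1) = (0, y.sign * ((k : ℤ) + 1)) := by
      have h' : k + 1 ≤ y.natAbs := h
      ext
      · simp [stdPath, Nat.sub_eq_zero_of_le h']
      · simp only [stdPath, min_eq_left h']; push_cast; ring
    rw [h1, h2]
    have h3 : toComplex (0, y.sign * ((k : ℤ) + 1)) - toComplex (0, y.sign * (k : ℤ)) =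
        (y.sign : ℂ) * Complex.I := by
      simp only [toComplex]; push_cast; ring
    rw [h3]
    rcases lt_trichotomy y 0 with hy | hy | hy
    · simp [Int.sign_eq_neg_one_of_neg hy]
    · subst hy; simp at h
    · simp [Int.sign_eq_one_of_pos hy]

theorem integral_zero (f : HalfLattice → ℂ) : integral f (0, 0) = 0 := by
  simp [integral, pathIntegral]

theorem integral_right (f : HalfLattice → ℂ) (x : ℕ) (y : ℤ) :
    integral f (x + 1, y) - integral f (x, y) = (f (x, y) + f (x + 1, y)) / 2 := by
  simp only [integral, pathIntegral]
  rw [← add_assoc, Finset.sum_range_succ, add_assoc, stdPath_end, stdPath_end, toComplex_right]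
  ring

theorem integral_up_zero (f : HalfLattice → ℂ) (y : ℤ) :
    integral f (0, y + 1) - integral f (0, y) = (f (0, y) + f (0, y + 1)) / 2 * Complex.I := by
  have key : ∀ (a b : ℤ), a.natAbs + 1 = b.natAbs →
      (∀ k ≤ a.natAbs, stdPath b k = stdPath a k) →
      integral f (0, b) - integral f (0, a) =
        (f (0, a) + f (0, b)) / 2 * (toComplex (0, b) - toComplex (0, a)) := by
    intro a b hab h
    have ha : stdPath a a.natAbs = (0, a) := by simpa using stdPath_end 0 a
    have hb : stdPath b (a.natAbs + 1) = (0, b) := by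
      rw [hab]; simpa using stdPath_end 0 b
    simp only [integral, pathIntegral, add_zero]
    rw [← hab, Finset.sum_range_succ, hb, h _ le_rfl, ha]
    have : ∀ k ∈ Finset.range a.natAbs,
        (f (stdPath b k) + f (stdPath b (k + 1))) / 2 *
            (toComplex (stdPath b (k + 1)) - toComplex (stdPath b k)) =
          (f (stdPath a k) + f (stdPath a (k + 1))) / 2 *
            (toComplex (stdPath a (k + 1)) - toComplex (stdPath a k)) := by
      intro k hk
      rw [Finset.mem_range] at hk
      rw [h k hk.le, h (k + 1) hk]
    rw [Finset.sum_congr rfl this]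
    ring
  rcases le_or_gt 0 y with hy | hy
  · rw [key y (y + 1) (by omega), toComplex_up]
    intro k hk
    have hk' : k ≤ (y + 1).natAbs := by omega
    rcases hy.eq_or_lt with h0 | h0
    · subst h0
      have : k = 0 := by simpa using hk
      subst this
      simp [stdPath_start]
    · simp [stdPath, Nat.sub_eq_zero_of_le hk, Nat.sub_eq_zero_of_le hk', min_eq_left hk,
        min_eq_left hk', Int.sign_eq_one_of_pos h0, Int.sign_eq_one_of_pos (by omega : 0 < y + 1)]
  · have h := key (y + 1) y (by omega) (by
      intro k hk
      have hk' : k ≤ y.natAbs := by omega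
      rcases (show y + 1 ≤ 0 by omega).eq_or_lt with h0 | h0
      · have : k = 0 := by rw [h0] at hk; simpa using hk
        subst this
        simp [stdPath_start]
      · simp [stdPath, Nat.sub_eq_zero_of_le hk, Nat.sub_eq_zero_of_le hk', min_eq_left hk,
          min_eq_left hk', Int.sign_eq_neg_one_of_neg h0, Int.sign_eq_neg_one_of_neg hy])
    linear_combination -h + (f (0, y) + f (0, y + 1)) / 2 * toComplex_up 0 y

theorem isDiscreteAnalytic_iff (f : HalfLattice → ℂ) :
    IsDiscreteAnalytic f ↔ ∀ (x : ℕ) (y : ℤ),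
      f (x + 1, y + 1) - f (x, y) = Complex.I * (f (x + 1, y) - f (x, y + 1)) := by
  have h1 : (1 + Complex.I) ≠ 0 := by
    intro h; simpa using congrArg Complex.re h
  have h2 : (1 - Complex.I) ≠ 0 := by
    intro h; simpa using congrArg Complex.re h
  have hI : Complex.I * Complex.I = -1 := Complex.I_mul_I
  refine forall_congr' fun x => forall_congr' fun y => ?_
  rw [div_eq_div_iff h1 h2]
  constructor
  · intro h
    linear_combination (1 + Complex.I) / 2 * h +
      ((f (x + 1, y + 1) - f (x, y)) / 2 + (f (x + 1, y) - f (x, y + 1)) / 2) * hI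
  · intro h
    linear_combination (1 - Complex.I) * h - (f (x + 1, y) - f (x, y + 1)) * hI

theorem integral_up {f : HalfLattice → ℂ} (hf : IsDiscreteAnalytic f) (x : ℕ) (y : ℤ) :
    integral f (x, y + 1) - integral f (x, y) =
      (f (x, y) + f (x, y + 1)) / 2 * Complex.I := by
  rw [isDiscreteAnalytic_iff] at hf
  have hI : Complex.I * Complex.I = -1 := Complex.I_mul_I
  induction x with
  | zero => exact integral_up_zero f y
  | succ x ih =>
    linear_combination ih + integral_right f x (y + 1) - integral_right f x y
      + (1 - Complex.I) / 2 * hf x y - (f (x + 1, y) - f (x, y + 1)) / 2 * hI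

theorem integral_step {f : HalfLattice → ℂ} (hf : IsDiscreteAnalytic f) {z w : HalfLattice}
    (h : ‖toComplex w - toComplex z‖ = 1) :
    integral f w - integral f z = (f z + f w) / 2 * (toComplex w - toComplex z) := by
  obtain ⟨a, b⟩ := z
  obtain ⟨c, d⟩ := w
  have h1 : ((c : ℤ) - a) * (c - a) + (d - b) * (d - b) = 1 := by
    have h2 : Complex.normSq (toComplex (c, d) - toComplex (a, b)) = 1 := by
      rw [Complex.normSq_eq_norm_sq, h, one_pow]
    simp only [toComplex, Complex.normSq_apply] at h2
    simp at h2
    exact_mod_cast h2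
  have hc : (c : ℤ) - a ≤ 1 ∧ -1 ≤ (c : ℤ) - a := by constructor <;> nlinarith [sq_nonneg (d - b)]
  have hd : d - b ≤ 1 ∧ -1 ≤ d - b := by constructor <;> nlinarith [sq_nonneg ((c : ℤ) - a)]
  have cases4 : (c = a + 1 ∧ d = b) ∨ (a = c + 1 ∧ d = b) ∨ (c = a ∧ d = b + 1) ∨
      (c = a ∧ b = d + 1) := by
    obtain ⟨u, hu⟩ : ∃ u : ℤ, u = (c : ℤ) - a := ⟨_, rfl⟩
    obtain ⟨v, hv⟩ : ∃ v : ℤ, v = d - b := ⟨_, rfl⟩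
    rw [← hu] at hc h1
    rw [← hv] at hd h1
    obtain ⟨hc1, hc2⟩ := hc
    obtain ⟨hd1, hd2⟩ := hd
    interval_cases u <;> interval_cases v <;> simp at h1 <;> omega
  rcases cases4 with ⟨rfl, rfl⟩ | ⟨rfl, rfl⟩ | ⟨rfl, rfl⟩ | ⟨rfl, rfl⟩
  · rw [integral_right, toComplex_right]; ring
  · have h3 := toComplex_right c d
    linear_combination -integral_right f c d - (f (c, d) + f (c + 1, d)) / 2 * -h3
  · rw [integral_up hf, toComplex_up]
  · have h3 := toComplex_up c d
    linear_combination -integral_up hf c d - (f (c, d) + f (c, d + 1)) / 2 * -h3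

/-- The integral of a discrete analytic function does not depend on the path. -/
theorem pathIntegral_eq_integral {f : HalfLattice → ℂ} (hf : IsDiscreteAnalytic f)
    (γ : ℕ → HalfLattice) (n : ℕ) (hγ : IsPath γ n) (h0 : γ 0 = (0, 0)) :
    pathIntegral f γ n = integral f (γ n) := by
  induction n with
  | zero => simp [pathIntegral, h0, integral_zero]
  | succ n ih =>
    have h1 := ih fun k hk => hγ k (hk.trans n.lt_succ_self)
    have h2 := integral_step hf (hγ n n.lt_succ_self)
    simp only [pathIntegral] at h1 ⊢
    rw [Finset.sum_range_succ, h1]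
    linear_combination -h2

/-! ### The operators on discrete analytic functions -/

theorem deltaX_apply (f : HalfLattice → ℂ) (z : HalfLattice) :
    deltaX f z = f (z.1 + 1, z.2) - f z := rfl

theorem opZ_apply (f : HalfLattice → ℂ) (z : HalfLattice) :
    opZ f z = (f (0, 0) - f z) / 2 + integral f z := rfl

theorem deltaX_opZ (f : HalfLattice → ℂ) : deltaX (opZ f) = f := by
  funext ⟨x, y⟩
  simp only [deltaX_apply, opZ_apply]
  linear_combination integral_right f x y

theorem opZ_zero (f : HalfLattice → ℂ) : opZ f (0, 0) = 0 := by
  simp [opZ_apply, integral_zero]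

theorem IsDiscreteAnalytic.opZ {f : HalfLattice → ℂ} (hf : IsDiscreteAnalytic f) :
    IsDiscreteAnalytic (opZ f) := by
  rw [isDiscreteAnalytic_iff]
  intro x y
  have hI : Complex.I * Complex.I = -1 := Complex.I_mul_I
  simp only [opZ_apply]
  linear_combination integral_right f x (y + 1) + (1 + Complex.I) * integral_up hf x y
    - Complex.I * integral_right f x y + (f (x, y) + f (x, y + 1)) / 2 * hI

theorem basisFun_zero : basisFun 0 = 1 := by simp [basisFun]

theorem basisFun_succ (n : ℕ) : basisFun (n + 1) = opZ (basisFun n) := by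
  simp [basisFun, pow_succ']

theorem basisFun_at_zero (n : ℕ) : basisFun n (0, 0) = if n = 0 then 1 else 0 := by
  cases n with
  | zero => simp [basisFun_zero]
  | succ n => simp [basisFun_succ, opZ_zero]

theorem deltaX_basisFun_zero : deltaX (basisFun 0) = 0 := by
  funext z; simp [basisFun_zero, deltaX_apply]

theorem deltaX_basisFun_succ (n : ℕ) : deltaX (basisFun (n + 1)) = basisFun n := by
  rw [basisFun_succ, deltaX_opZ]

/-- `f(z) = ∑ₙ a(n) z⁽ⁿ⁾` for every `z ∈ Λ₊`. -/
def HasExpansion (a : ℕ → ℂ) (f : HalfLattice → ℂ) : Prop :=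
  ∀ z, HasSum (fun n => a n * basisFun n z) (f z)

theorem HasExpansion.deltaX {a : ℕ → ℂ} {f : HalfLattice → ℂ} (h : HasExpansion a f) :
    HasExpansion (fun n => a (n + 1)) (deltaX f) := by
  intro z
  have h1 := (h (z.1 + 1, z.2)).sub (h z)
  have h2 : HasSum (fun n => a n * DiscreteAnalytic.deltaX (basisFun n) z)
      (DiscreteAnalytic.deltaX f z) := by
    refine h1.congr_fun ?_
    intro n
    simp only [deltaX_apply]; ring
  have h3 := (hasSum_nat_add_iff' 1).2 h2
  simpa [deltaX_basisFun_zero, deltaX_basisFun_succ] using h3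

theorem HasExpansion.coeff_eq {a : ℕ → ℂ} {f : HalfLattice → ℂ} (h : HasExpansion a f) :
    coeff f = a := by
  funext n
  induction n generalizing a f with
  | zero =>
    have h1 : HasSum (fun n => a n * basisFun n (0, 0)) (a 0) := by
      have := hasSum_single (f := fun n => a n * basisFun n (0, 0)) 0
        fun n hn => by simp [basisFun_at_zero, hn]
      simpa [basisFun_at_zero] using this
    simpa [coeff] using (h (0, 0)).unique h1
  | succ n ih =>
    have := ih h.deltaX
    rw [← this]
    simp [coeff, pow_succ]

theorem HasExpansion.opZ {a : ℕ → ℂ} {f : HalfLattice → ℂ} (h : HasExpansion a f) :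
    HasExpansion (fun n => if n = 0 then 0 else a (n - 1)) (opZ f) := by
  intro z
  have h1 : HasSum (fun n => a n * DiscreteAnalytic.opZ (basisFun n) z)
      (DiscreteAnalytic.opZ f z) := by
    have h2 : HasSum (fun n => ∑ k ∈ Finset.range (z.2.natAbs + z.1),
        (a n * basisFun n (stdPath z.2 k) + a n * basisFun n (stdPath z.2 (k + 1))) / 2 *
          (toComplex (stdPath z.2 (k + 1)) - toComplex (stdPath z.2 k))) (integral f z) :=
      hasSum_sum fun k _ => (((h _).add (h _)).div_const 2).mul_right _
    refine ((((h (0, 0)).sub (h z)).div_const 2).add h2).congr_fun ?_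
    intro n
    simp only [opZ_apply, integral, pathIntegral, mul_add, Finset.mul_sum]
    congr 1
    · ring
    · exact Finset.sum_congr rfl fun k _ => by ring
  have h3 := (hasSum_nat_add_iff' (f := fun n => (if n = 0 then 0 else a (n - 1)) * basisFun n z)
    (g := DiscreteAnalytic.opZ f z) 1).1
  apply h3
  simpa [basisFun_succ] using h1

/-! ### The Hardy space -/

/-- The functions of the Hardy space `H₂(Λ₊)`: discrete analytic functions on `Λ₊` of the form
`f(z) = ∑ₙ a(n) z⁽ⁿ⁾` with `∑ₙ |a(n)|² < ∞`. -/
def hardySubmodule : Submodule ℂ (HalfLattice → ℂ) where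
  carrier := {f | IsDiscreteAnalytic f ∧
    ∃ a : ℕ → ℂ, Summable (fun n => ‖a n‖ ^ 2) ∧ HasExpansion a f}
  zero_mem' := by
    refine ⟨fun x y => by simp, 0, by simp, fun z => ?_⟩
    simp
  add_mem' := by
    rintro f g ⟨hf, a, ha, hfa⟩ ⟨hg, b, hb, hgb⟩
    refine ⟨?_, a + b, ?_, fun z => ?_⟩
    · rw [isDiscreteAnalytic_iff] at *
      intro x y
      simp only [Pi.add_apply]
      linear_combination hf x y + hg x y
    · refine Summable.of_nonneg_of_le (fun n => by positivity) (fun n => ?_)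
        ((ha.add hb).mul_left 2)
      have h1 : ‖a n + b n‖ ≤ ‖a n‖ + ‖b n‖ := norm_add_le _ _
      have h2 : ‖a n + b n‖ ^ 2 ≤ (‖a n‖ + ‖b n‖) ^ 2 := by gcongr
      simp only [Pi.add_apply]
      nlinarith [sq_nonneg (‖a n‖ - ‖b n‖)]
    · refine ((hfa z).add (hgb z)).congr_fun ?_
      intro n; simp only [Pi.add_apply]; ring
  smul_mem' := by
    rintro c f ⟨hf, a, ha, hfa⟩
    refine ⟨?_, c • a, ?_, fun z => ?_⟩
    · rw [isDiscreteAnalytic_iff] at *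
      intro x y
      simp only [Pi.smul_apply, smul_eq_mul]
      linear_combination c * hf x y
    · refine (ha.mul_left (‖c‖ ^ 2)).congr fun n => ?_
      simp [mul_pow]
    · refine ((hfa z).mul_left c).congr_fun ?_
      intro n; simp only [Pi.smul_apply, smul_eq_mul]; ring

/-- The Hardy space `H₂(Λ₊)`, as a type of its own: it carries the topology of its inner product
and not the one of pointwise convergence. -/
def HardySpace : Type := hardySubmodule

namespace HardySpace

instance instAddCommGroup : AddCommGroup HardySpace :=
  inferInstanceAs (AddCommGroup hardySubmodule)

instance instModule : Module ℂ HardySpace :=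
  inferInstanceAs (Module ℂ hardySubmodule)

/-- The function on `Λ₊` that an element of the Hardy space is. -/
def toFun : HardySpace →ₗ[ℂ] (HalfLattice → ℂ) := hardySubmodule.subtype

instance instCoeFun : CoeFun HardySpace fun _ => HalfLattice → ℂ := ⟨fun f => toFun f⟩

theorem toFun_injective : Function.Injective toFun := Subtype.val_injective

theorem toFun_mem (f : HardySpace) : toFun f ∈ hardySubmodule := Subtype.property f

theorem hasExpansion (f : HardySpace) : HasExpansion (coeff f) f := by
  obtain ⟨-, a, -, h⟩ := toFun_mem f
  rwa [h.coeff_eq]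

theorem summable_coeff (f : HardySpace) : Summable fun n => ‖coeff f n‖ ^ 2 := by
  obtain ⟨-, a, ha, h⟩ := toFun_mem f
  rwa [h.coeff_eq]

theorem coeff_add (f g : HardySpace) (n : ℕ) :
    coeff (f + g : HardySpace) n = coeff f n + coeff g n := by
  simp [coeff]

theorem coeff_smul (c : ℂ) (f : HardySpace) (n : ℕ) :
    coeff (c • f : HardySpace) n = c * coeff f n := by
  simp [coeff]

theorem summable_inner (f g : HardySpace) : Summable fun n => conj (coeff f n) * coeff g n := by
  refine Summable.of_norm_bounded ((summable_coeff f).add (summable_coeff g)) fun n => ?_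
  rw [norm_mul, RCLike.norm_conj]
  nlinarith [sq_nonneg (‖coeff f n‖ - ‖coeff g n‖), sq_nonneg ‖coeff f n‖, sq_nonneg ‖coeff g n‖]

theorem inner_self_eq (f : HardySpace) :
    ∑' n, conj (coeff f n) * coeff f n = ((∑' n, ‖coeff f n‖ ^ 2 : ℝ) : ℂ) := by
  rw [Complex.ofReal_tsum]
  refine tsum_congr fun n => ?_
  rw [Complex.conj_mul']; push_cast; rfl

/-- The inner product `∑ₙ f̂(n) ĝ(n)*`; as everywhere in Mathlib it is written with the
conjugate-linear variable first. -/
abbrev core : InnerProductSpace.Core ℂ HardySpace where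
  inner f g := ∑' n, conj (coeff f n) * coeff g n
  conj_inner_symm f g := by
    rw [Complex.conj_tsum]
    exact tsum_congr fun n => by simp [mul_comm]
  re_inner_nonneg f := by
    rw [inner_self_eq]
    exact tsum_nonneg fun n => by positivity
  add_left f g k := by
    rw [← (summable_inner f k).tsum_add (summable_inner g k)]
    exact tsum_congr fun n => by rw [coeff_add, map_add]; ring
  smul_left f g c := by
    rw [← tsum_mul_left]
    exact tsum_congr fun n => by rw [coeff_smul, map_mul]; ring
  definite f h := by
    rw [inner_self_eq, Complex.ofReal_eq_zero] at h
    have h' := (hasSum_zero_iff_of_nonneg fun n => sq_nonneg ‖coeff f n‖).1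
      (h ▸ (summable_coeff f).hasSum)
    refine toFun_injective ?_
    funext z
    refine (hasExpansion f z).unique ?_
    have h0 : ∀ n, coeff f n = 0 := fun n => by simpa using congrFun h' n
    simp [h0]

instance instNormedAddCommGroup : NormedAddCommGroup HardySpace := core.toNormedAddCommGroup

instance instInnerProductSpace : InnerProductSpace ℂ HardySpace :=
  InnerProductSpace.ofCore core.toCore

theorem inner_def (f g : HardySpace) :
    inner ℂ f g = ∑' n, conj (coeff f n) * coeff g n := rfl

/-- The discrete integration operator `Z` on the Hardy space. -/
def Z : HardySpace →ₗ[ℂ] HardySpace :=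
  opZ.restrict (p := hardySubmodule) (q := hardySubmodule) (by
    rintro f ⟨hf, a, ha, hfa⟩
    refine ⟨hf.opZ, _, ?_, hfa.opZ⟩
    rw [← summable_nat_add_iff 1]
    simpa using ha)

theorem Z_apply (f : HardySpace) : (Z f : HalfLattice → ℂ) = opZ f := rfl

end HardySpace

/-! ### Schur functions and convolution operators -/

/-- The kernel `Kˢ_w(z) = ∑ₙ (z⁽ⁿ⁾ w⁽ⁿ⁾* - (Zⁿ s)(z) (Zⁿ s)(w)*)`, as a matrix whose row index is
`z` and whose column index is `w`. -/
def schurKernel (s : HalfLattice → ℂ) : Matrix HalfLattice HalfLattice ℂ :=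
  Matrix.of fun z w =>
    ∑' n : ℕ, (basisFun n z * conj (basisFun n w) - (opZ ^ n) s z * conj ((opZ ^ n) s w))

/-- `s` is a discrete analytic Schur function on `Λ₊`. -/
structure IsSchurFunction (s : HalfLattice → ℂ) : Prop where
  isDiscreteAnalytic : IsDiscreteAnalytic s
  summable : ∀ z, Summable fun n : ℕ => ‖(opZ ^ n) s z‖ ^ 2
  posSemidef : (schurKernel s).PosSemidef

/-- `g = s ⊙ f`: for every `z ∈ Λ₊`, the convolution product
`(s ⊙ f)(z) = ∑ₙ (∑_{m ≤ n} ŝ(m) f̂(n - m)) z⁽ⁿ⁾` converges, to `g(z)`. -/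
def IsConvolution (s f g : HalfLattice → ℂ) : Prop :=
  HasExpansion (fun n => ∑ m ∈ Finset.range (n + 1), coeff s m * coeff f (n - m)) g

end

end DiscreteAnalytic

/-! Taylor coefficients identify the Hardy space with `ℓ²` and turn `Z` into the unilateral shift,
so this is Beurling's theorem, proved by wandering vectors. The lattice enters through
`geometricDecay_basisFun`: every square summable sequence defines a function, so the space is
complete and evaluation at a point has a reproducing kernel.

For invariant `H`, the wandering space `H ⊖ Z H` is nonzero, since only `0` is divisible by every
power of `Z` (`eq_zero_of_forall_exists_Z`). A unit vector `s` in it has an orthonormal orbit `Zⁿ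
s`, so `f ↦ s ⊙ f` is an isometry. Commutativity of `⊙` makes the wandering space one-dimensional
(`eq_zero_of_wandering`), hence the range is all of `H` (`range_convIsometry`). The kernel of `s` is
positive because it is the Gram matrix of the reproducing kernels projected off the range
(`schurKernel_eq`). Conversely, convolution operators commute with `Z`. -/

/-! ### Gram matrices and range projections of isometries -/

theorem Matrix.posSemidef_of_inner {ι E : Type*} [NormedAddCommGroup E] [InnerProductSpace ℂ E]
    (v : ι → E) : (Matrix.of fun i j => inner ℂ (v i) (v j) : Matrix ι ι ℂ).PosSemidef := by
  refine ⟨Matrix.ext fun i j => by simp [Matrix.conjTranspose_apply], fun x => ?_⟩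
  have h : (x.sum fun i xi => x.sum fun j xj =>
      star xi * (Matrix.of fun i j => inner ℂ (v i) (v j) : Matrix ι ι ℂ) i j * xj) =
      inner ℂ (∑ i ∈ x.support, x i • v i) (∑ i ∈ x.support, x i • v i) := by
    simp only [Finsupp.sum, sum_inner]
    refine Finset.sum_congr rfl fun i _ => ?_
    rw [inner_sum]
    refine Finset.sum_congr rfl fun j _ => ?_
    rw [inner_smul_left, inner_smul_right, Matrix.of_apply, RCLike.star_def]
    ring
  rw [h, inner_self_eq_norm_sq_to_K]
  exact pow_nonneg (RCLike.ofReal_nonneg.2 (norm_nonneg _)) 2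

/-- `M M*` is the orthogonal projection onto the range of the isometry `M`. -/
theorem LinearIsometry.inner_map_sub_adjoint {E F : Type*} [NormedAddCommGroup E]
    [InnerProductSpace ℂ E] [CompleteSpace E] [NormedAddCommGroup F] [InnerProductSpace ℂ F]
    [CompleteSpace F] (M : E →ₗᵢ[ℂ] F) (x : E) (y : F) :
    inner ℂ (M x) (y - M (M.toContinuousLinearMap.adjoint y)) = 0 := by
  rw [inner_sub_right, M.inner_map_map, ContinuousLinearMap.adjoint_inner_right]
  simp

namespace DiscreteAnalytic

noncomputable section

/-! ### Growth of the discrete analytic polynomials -/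

theorem basisFun_isDiscreteAnalytic (n : ℕ) : IsDiscreteAnalytic (basisFun n) := by
  induction n with
  | zero =>
    rw [basisFun_zero, isDiscreteAnalytic_iff]
    intro x y
    simp
  | succ n ih => rw [basisFun_succ]; exact ih.opZ

theorem basisFun_succ_right (n x : ℕ) (y : ℤ) :
    basisFun (n + 1) (x + 1, y) = basisFun (n + 1) (x, y) + basisFun n (x, y) := by
  have h := congrFun (deltaX_basisFun_succ n) (x, y)
  rw [deltaX_apply] at h
  linear_combination h

/-- Eliminating the values at abscissa `x + 1` from discrete analyticity leaves a recurrence between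
vertical neighbours. -/
theorem basisFun_succ_up (n x : ℕ) (y : ℤ) :
    (1 + Complex.I) * basisFun (n + 1) (x, y + 1) + basisFun n (x, y + 1) =
      (1 + Complex.I) * basisFun (n + 1) (x, y) + Complex.I * basisFun n (x, y) := by
  have h := (isDiscreteAnalytic_iff _).1 (basisFun_isDiscreteAnalytic (n + 1)) x y
  linear_combination h - basisFun_succ_right n x (y + 1) + Complex.I * basisFun_succ_right n x y

/-- A sequence decays geometrically at the rate `7 / 8`. -/
def GeometricDecay (u : ℕ → ℂ) : Prop := ∃ C : ℝ, ∀ n, ‖u n‖ ≤ C * (7 / 8) ^ n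

/-- `7 / 8` exceeds `1 / √2`, the inverse of the radius of convergence of `∑ₙ z⁽ⁿ⁾ tⁿ`. -/
theorem GeometricDecay.of_recurrence {u v : ℕ → ℂ} {c d : ℂ} (hc : ‖c‖ = 1) (hd : ‖d‖ = 1)
    (h0 : u 0 = v 0)
    (h : ∀ n, (1 + Complex.I) * u (n + 1) + c * u n = (1 + Complex.I) * v (n + 1) + d * v n)
    (hv : GeometricDecay v) : GeometricDecay u := by
  obtain ⟨C, hC⟩ := hv
  have hC0 : 0 ≤ C := by simpa using (norm_nonneg _).trans (hC 0)
  -- A rational lower bound for `√2`, so that dividing by the norm costs at most a factor `3 / 4`.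
  have hn : 4 / 3 ≤ ‖(1 + Complex.I : ℂ)‖ := by
    rw [Complex.norm_def]
    refine Real.le_sqrt_of_sq_le ?_
    simp [Complex.normSq_apply]; norm_num
  -- The induction with constant `K * C` needs `3/4 * (1 + K) + 7/8 ≤ 7/8 * K`, that is `K ≥ 13`.
  refine ⟨13 * C, fun n => ?_⟩
  induction n with
  | zero => rw [h0]; have := hC 0; simp at this ⊢; linarith
  | succ n ih =>
    have h1 : (1 + Complex.I) * (u (n + 1) - v (n + 1)) = d * v n - c * u n := by
      linear_combination h n
    have h2 : ‖(1 + Complex.I : ℂ)‖ * ‖u (n + 1) - v (n + 1)‖ ≤ ‖v n‖ + ‖u n‖ := by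
      rw [← norm_mul, h1]
      refine (norm_sub_le _ _).trans_eq ?_
      rw [norm_mul, norm_mul, hc, hd, one_mul, one_mul]
    have h3 : 4 / 3 * ‖u (n + 1) - v (n + 1)‖ ≤ ‖v n‖ + ‖u n‖ :=
      (mul_le_mul_of_nonneg_right hn (norm_nonneg _)).trans h2
    have h4 : ‖u (n + 1)‖ ≤ ‖u (n + 1) - v (n + 1)‖ + ‖v (n + 1)‖ := by
      simpa using norm_add_le (u (n + 1) - v (n + 1)) (v (n + 1))
    have h5 := hC n
    have h6 := hC (n + 1)
    rw [pow_succ] at h6 ⊢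
    have : 0 ≤ C * (7 / 8) ^ n := by positivity
    linarith

theorem basisFun_zero_apply (z : HalfLattice) : basisFun 0 z = 1 := by simp [basisFun_zero]

/-- Decay spreads from the origin along the imaginary axis, then to the right. A downward step reads
the vertical recurrence backwards, which swaps the coefficients `1` and `I`, both of modulus one. -/
theorem geometricDecay_basisFun (z : HalfLattice) : GeometricDecay fun n => basisFun n z := by
  obtain ⟨x, y⟩ := z
  induction x with
  | zero =>
    induction y using Int.induction_on with
    | zero =>
      refine ⟨1, fun n => ?_⟩
      beta_reduce
      rw [basisFun_at_zero]
      split_ifs with h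
      · simp [h]
      · simp; positivity
    | succ y ih =>
      exact ih.of_recurrence (c := 1) (by simp) Complex.norm_I
        (by simp only [basisFun_zero_apply]) fun n => by
          rw [one_mul]; exact basisFun_succ_up n 0 y
    | pred y ih =>
      refine ih.of_recurrence (d := 1) Complex.norm_I (by simp)
        (by simp only [basisFun_zero_apply]) fun n => ?_
      have := basisFun_succ_up n 0 (-y - 1)
      rw [sub_add_cancel] at this
      rw [one_mul, this]
  | succ x ih =>
    obtain ⟨C, hC⟩ := ih
    have hC0 : 0 ≤ C := by simpa using (norm_nonneg _).trans (hC 0)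
    refine ⟨3 * C, fun n => ?_⟩
    cases n with
    | zero => have := hC 0; simp [basisFun_zero_apply] at this ⊢; linarith
    | succ n =>
      have h1 := hC n
      have h2 := hC (n + 1)
      have h3 := norm_add_le (basisFun (n + 1) (x, y)) (basisFun n (x, y))
      simp only [basisFun_succ_right]
      rw [pow_succ] at h2 ⊢
      have : 0 ≤ C * (7 / 8) ^ n := by positivity
      linarith

theorem summable_norm_sq_basisFun (z : HalfLattice) :
    Summable fun n => ‖basisFun n z‖ ^ 2 := by
  obtain ⟨C, hC⟩ := geometricDecay_basisFun z
  refine Summable.of_nonneg_of_le (fun n => by positivity)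
    (fun n => pow_le_pow_left₀ (norm_nonneg _) (hC n) 2) ?_
  have : Summable fun n : ℕ => C ^ 2 * ((49 : ℝ) / 64) ^ n :=
    (summable_geometric_of_lt_one (by norm_num) (by norm_num)).mul_left _
  refine this.congr fun n => ?_
  rw [mul_pow, ← pow_mul, mul_comm n 2, pow_mul]; norm_num

theorem summable_mul_basisFun {a : ℕ → ℂ} (ha : Summable fun n => ‖a n‖ ^ 2) (z : HalfLattice) :
    Summable fun n => a n * basisFun n z := by
  refine Summable.of_norm_bounded (ha.add (summable_norm_sq_basisFun z)) fun n => ?_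
  rw [norm_mul]
  nlinarith [sq_nonneg (‖a n‖ - ‖basisFun n z‖), sq_nonneg ‖a n‖, sq_nonneg ‖basisFun n z‖]

theorem HasExpansion.isDiscreteAnalytic {a : ℕ → ℂ} {f : HalfLattice → ℂ}
    (h : HasExpansion a f) : IsDiscreteAnalytic f := by
  rw [isDiscreteAnalytic_iff]
  intro x y
  refine ((h _).sub (h _)).unique ((((h _).sub (h _)).mul_left Complex.I).congr_fun ?_)
  intro n
  have := (isDiscreteAnalytic_iff _).1 (basisFun_isDiscreteAnalytic n) x y
  linear_combination a n * this

namespace HardySpace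

/-! ### The Hardy space as a Hilbert space -/

/-- The element of the Hardy space with given square summable Taylor coefficients. -/
def ofCoeff (a : ℕ → ℂ) (ha : Summable fun n => ‖a n‖ ^ 2) : HardySpace :=
  ⟨fun z => ∑' n, a n * basisFun n z,
    HasExpansion.isDiscreteAnalytic (a := a) fun z => (summable_mul_basisFun ha z).hasSum,
    a, ha, fun z => (summable_mul_basisFun ha z).hasSum⟩

theorem coeff_ofCoeff {a : ℕ → ℂ} (ha : Summable fun n => ‖a n‖ ^ 2) :
    coeff (ofCoeff a ha) = a :=
  HasExpansion.coeff_eq fun z => (summable_mul_basisFun ha z).hasSum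

theorem ext_coeff {f g : HardySpace} (h : ∀ n, coeff f n = coeff g n) : f = g := by
  refine toFun_injective (funext fun z => (hasExpansion f z).unique ?_)
  rw [funext h]
  exact hasExpansion g z

theorem norm_sq_eq (f : HardySpace) : ‖f‖ ^ 2 = ∑' n, ‖coeff f n‖ ^ 2 := by
  have h := inner_self_eq_norm_sq_to_K (𝕜 := ℂ) f
  rw [inner_def, inner_self_eq] at h
  refine Complex.ofReal_injective ?_
  rw [Complex.ofReal_pow]
  exact h.symm

/-- The Taylor coefficients, as an isometry into `ℓ²`. -/
def coeffIsometry : HardySpace →ₗᵢ[ℂ] lp (fun _ : ℕ => ℂ) 2 where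
  toFun f := ⟨coeff f, memℓp_gen (by simpa using summable_coeff f)⟩
  map_add' f g := Subtype.ext (funext fun n => coeff_add f g n)
  map_smul' c f := Subtype.ext (funext fun n => coeff_smul c f n)
  norm_map' f := by
    rw [← sq_eq_sq₀ (norm_nonneg _) (norm_nonneg _), norm_sq_eq]
    simpa using lp.norm_rpow_eq_tsum (p := 2) (by simp)
      (⟨coeff f, memℓp_gen (by simpa using summable_coeff f)⟩ : lp (fun _ : ℕ => ℂ) 2)

/-- The Hardy space is isometric to `ℓ²`. -/
def coeffEquiv : HardySpace ≃ₗᵢ[ℂ] lp (fun _ : ℕ => ℂ) 2 :=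
  LinearIsometryEquiv.ofSurjective coeffIsometry fun a =>
    ⟨ofCoeff a (by simpa using (lp.memℓp a).summable (by simp)), Subtype.ext (coeff_ofCoeff _)⟩

instance instCompleteSpace : CompleteSpace HardySpace :=
  (completeSpace_congr (e := coeffEquiv.toEquiv) coeffEquiv.isometry.isUniformEmbedding).2
    inferInstance

/-- The polynomial `z⁽ⁿ⁾` as an element of the Hardy space. -/
def monomial (n : ℕ) : HardySpace :=
  ofCoeff (Pi.single n 1) (summable_of_ne_finset_zero (s := {n}) fun k hk => by
    simp [Pi.single_eq_of_ne (by simpa using hk : k ≠ n)])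

theorem coeff_monomial (n : ℕ) : coeff (monomial n) = Pi.single n 1 := coeff_ofCoeff _

theorem inner_monomial (n : ℕ) (f : HardySpace) : inner ℂ (monomial n) f = coeff f n := by
  rw [inner_def, coeff_monomial, tsum_eq_single n fun k hk => by simp [Pi.single_eq_of_ne hk]]
  simp

theorem hasSum_coeff {u : ℕ → HardySpace} {f : HardySpace} (h : HasSum u f) (n : ℕ) :
    HasSum (fun k => coeff (u k) n) (coeff f n) := by
  simpa [inner_monomial] using h.mapL (innerSL ℂ (monomial n))

/-- The reproducing kernel of the Hardy space. -/
def reproducing (z : HalfLattice) : HardySpace :=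
  ofCoeff (fun n => conj (basisFun n z)) (by simpa using summable_norm_sq_basisFun z)

theorem coeff_reproducing (z : HalfLattice) (n : ℕ) :
    coeff (reproducing z) n = conj (basisFun n z) := by
  rw [reproducing, coeff_ofCoeff]

theorem inner_reproducing (z : HalfLattice) (f : HardySpace) :
    inner ℂ (reproducing z) f = f z := by
  rw [inner_def, ← (hasExpansion f z).tsum_eq]
  exact tsum_congr fun n => by rw [coeff_reproducing, Complex.conj_conj, mul_comm]

/-! ### The shift -/

theorem coeff_Z_zero (f : HardySpace) : coeff (Z f) 0 = 0 := by
  rw [Z_apply, (hasExpansion f).opZ.coeff_eq]; simp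

theorem coeff_Z_succ (f : HardySpace) (n : ℕ) : coeff (Z f) (n + 1) = coeff f n := by
  rw [Z_apply, (hasExpansion f).opZ.coeff_eq]; simp

theorem inner_Z (f g : HardySpace) : inner ℂ (Z f) (Z g) = inner ℂ f g := by
  rw [inner_def, (summable_inner _ _).tsum_eq_zero_add, inner_def]
  simp [coeff_Z_zero, coeff_Z_succ]

/-- `Z` as an isometry. -/
def isometryZ : HardySpace →ₗᵢ[ℂ] HardySpace :=
  Z.isometryOfInner inner_Z

theorem Z_pow_apply (n : ℕ) (f : HardySpace) :
    ((Z ^ n) f : HalfLattice → ℂ) = (opZ ^ n) f := by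
  induction n with
  | zero => simp
  | succ n ih => rw [pow_succ', pow_succ', Module.End.mul_apply, Module.End.mul_apply, Z_apply, ih]

theorem inner_Z_pow (n : ℕ) (f g : HardySpace) :
    inner ℂ ((Z ^ n) f) ((Z ^ n) g) = inner ℂ f g := by
  induction n with
  | zero => simp
  | succ n ih => rw [pow_succ', Module.End.mul_apply, Module.End.mul_apply, inner_Z, ih]

theorem coeff_Z_pow (k n : ℕ) (f : HardySpace) :
    coeff ((Z ^ k) f) n = if k ≤ n then coeff f (n - k) else 0 := by
  induction k generalizing n with
  | zero => simp
  | succ k ih =>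
    rw [pow_succ', Module.End.mul_apply]
    cases n with
    | zero => simp [coeff_Z_zero]
    | succ n => simp [coeff_Z_succ, ih]

/-! ### Isometric convolution operators -/

/-- `Z` is isometric, so a common power cancels from both sides of an inner product. -/
theorem orthonormal_Z_pow {s : HardySpace} (h1 : ‖s‖ = 1)
    (h : ∀ k, inner ℂ s ((Z ^ (k + 1)) s) = 0) : Orthonormal ℂ fun n => (Z ^ n) s := by
  have key : ∀ m k, inner ℂ ((Z ^ m) s) ((Z ^ (m + (k + 1))) s) = 0 := fun m k => by
    rw [pow_add, Module.End.mul_apply, inner_Z_pow, h]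
  refine ⟨fun n => ?_, fun m n hmn => ?_⟩
  · rw [← h1, ← sq_eq_sq₀ (norm_nonneg _) (norm_nonneg _),
      ← inner_self_eq_norm_sq (𝕜 := ℂ), inner_Z_pow, inner_self_eq_norm_sq]
  · rcases lt_or_gt_of_ne hmn with h | h
    · obtain ⟨k, rfl⟩ := Nat.exists_eq_add_of_lt h
      exact key m k
    · obtain ⟨k, rfl⟩ := Nat.exists_eq_add_of_lt h
      exact inner_eq_zero_symm.1 (key n k)

/-- The isometry `f ↦ s ⊙ f = ∑ₙ f̂(n) Zⁿ s`, for `s` whose images `Zⁿ s` are orthonormal. -/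
def convIsometry {s : HardySpace} (hs : Orthonormal ℂ fun n => (Z ^ n) s) :
    HardySpace →ₗᵢ[ℂ] HardySpace :=
  hs.orthogonalFamily.linearIsometry.comp coeffEquiv.toLinearIsometry

section ConvIsometry

variable {s : HardySpace} (hs : Orthonormal ℂ fun n => (Z ^ n) s)

theorem hasSum_convIsometry (f : HardySpace) :
    HasSum (fun n => coeff f n • (Z ^ n) s) (convIsometry hs f) :=
  hs.orthogonalFamily.hasSum_linearIsometry (coeffEquiv f)

theorem convIsometry_monomial (n : ℕ) : convIsometry hs (monomial n) = (Z ^ n) s := by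
  refine (hasSum_convIsometry hs _).unique ?_
  rw [coeff_monomial]
  simpa using hasSum_single (f := fun k => (Pi.single n 1 : ℕ → ℂ) k • (Z ^ k) s) n
    fun k hk => by simp [Pi.single_eq_of_ne hk]

/-- The coefficients of `Zᵏ s` vanish below degree `k`, so only `k ≤ n` contributes; the reflection
substitutes `k = n - m`. -/
theorem coeff_convIsometry (f : HardySpace) (n : ℕ) :
    coeff (convIsometry hs f) n =
      ∑ m ∈ Finset.range (n + 1), coeff s m * coeff f (n - m) := by
  have h := hasSum_coeff (hasSum_convIsometry hs f) n
  have h' := hasSum_sum_of_ne_finset_zero (L := .unconditional ℕ)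
    (f := fun k => coeff (coeff f k • (Z ^ k) s : HardySpace) n)
    (s := Finset.range (n + 1)) fun k hk => by
      rw [coeff_smul, coeff_Z_pow, if_neg (by simpa using hk), mul_zero]
  rw [h.unique h', ← Finset.sum_range_reflect]
  refine Finset.sum_congr rfl fun m hm => ?_
  have hm' : m ≤ n := Nat.lt_succ_iff.1 (Finset.mem_range.1 hm)
  rw [coeff_smul, coeff_Z_pow, if_pos (by omega), mul_comm,
    show n - (n + 1 - 1 - m) = m by omega, show n + 1 - 1 - m = n - m by omega]

theorem isConvolution_convIsometry (f : HardySpace) : IsConvolution s f (convIsometry hs f) := by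
  rw [IsConvolution, ← funext (coeff_convIsometry hs f)]
  exact hasExpansion _

theorem convIsometry_comm {t : HardySpace} (ht : Orthonormal ℂ fun n => (Z ^ n) t) :
    convIsometry hs t = convIsometry ht s := by
  refine ext_coeff fun n => ?_
  rw [coeff_convIsometry, coeff_convIsometry, ← Finset.sum_range_reflect]
  refine Finset.sum_congr rfl fun m hm => ?_
  have hm' : m ≤ n := Nat.lt_succ_iff.1 (Finset.mem_range.1 hm)
  rw [mul_comm, show n - (n + 1 - 1 - m) = m by omega, show n + 1 - 1 - m = n - m by omega]

end ConvIsometry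

/-- Two orthonormal shift orbits cannot be orthogonal to each other. -/
theorem exists_inner_Z_pow_ne_zero {s t : HardySpace} (hs : Orthonormal ℂ fun n => (Z ^ n) s)
    (ht : Orthonormal ℂ fun n => (Z ^ n) t) :
    ∃ m n, inner ℂ ((Z ^ m) s) ((Z ^ n) t) ≠ 0 := by
  by_contra! h
  have h1 : ∀ m, inner ℂ ((Z ^ m) s) (convIsometry hs t) = 0 := fun m => by
    -- `s ⊙ t = t ⊙ s` is a series in both orbits. As a series in the `Zⁿ t` it is orthogonal to
    -- every `Zᵐ s`; as a series in the `Zᵐ s` it is then orthogonal to itself, although its norm is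
    -- `‖t‖ = 1`.
    rw [convIsometry_comm hs ht]
    refine ((hasSum_convIsometry ht s).mapL (innerSL ℂ ((Z ^ m) s))).unique ?_
    simp [h]
  have h2 : inner ℂ (convIsometry hs t) (convIsometry hs t) = (0 : ℂ) := by
    refine ((hasSum_convIsometry hs t).mapL (innerSL ℂ (convIsometry hs t))).unique ?_
    simp [inner_eq_zero_symm.1 (h1 _)]
  have h3 : ‖convIsometry hs t‖ = 1 := by
    simpa using ht.1 0
  rw [inner_self_eq_zero] at h2
  simp [h2] at h3

theorem coeff_adjoint_reproducing {s : HardySpace} (hs : Orthonormal ℂ fun n => (Z ^ n) s)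
    (z : HalfLattice) (n : ℕ) :
    coeff ((convIsometry hs).toContinuousLinearMap.adjoint (reproducing z)) n =
      conj ((opZ ^ n) s z) := by
  rw [← inner_monomial, ContinuousLinearMap.adjoint_inner_right, ← inner_conj_symm,
    LinearIsometry.coe_toContinuousLinearMap, convIsometry_monomial, inner_reproducing,
    Z_pow_apply]

/-- With `k_z` the reproducing kernel, `1 - M M*` is a projection, so the right side is `⟨k_z, k_w⟩
- ⟨M* k_z, M* k_w⟩`; comparing coefficients gives the kernel. -/
theorem schurKernel_eq {s : HardySpace} (hs : Orthonormal ℂ fun n => (Z ^ n) s)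
    (z w : HalfLattice) :
    schurKernel s z w = inner ℂ
      (reproducing z - convIsometry hs
        ((convIsometry hs).toContinuousLinearMap.adjoint (reproducing z)))
      (reproducing w - convIsometry hs
        ((convIsometry hs).toContinuousLinearMap.adjoint (reproducing w))) := by
  set A := (convIsometry hs).toContinuousLinearMap.adjoint with hA
  have h1 : inner ℂ (reproducing z) (convIsometry hs (A (reproducing w))) =
      inner ℂ (A (reproducing z)) (A (reproducing w)) := by
    rw [hA, ContinuousLinearMap.adjoint_inner_left]; rfl
  rw [inner_sub_left, LinearIsometry.inner_map_sub_adjoint, sub_zero, inner_sub_right, h1,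
    inner_def, inner_def, ← (summable_inner _ _).tsum_sub (summable_inner _ _)]
  refine tsum_congr fun n => ?_
  rw [coeff_reproducing, coeff_reproducing, hA, coeff_adjoint_reproducing,
    coeff_adjoint_reproducing, Complex.conj_conj, Complex.conj_conj]

theorem isSchurFunction {s : HardySpace} (hs : Orthonormal ℂ fun n => (Z ^ n) s) :
    IsSchurFunction s where
  isDiscreteAnalytic := (toFun_mem s).1
  summable z := by
    refine (summable_coeff
      ((convIsometry hs).toContinuousLinearMap.adjoint (reproducing z))).congr fun n => ?_
    rw [coeff_adjoint_reproducing, RCLike.norm_conj]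
  posSemidef := by
    have h : schurKernel s = Matrix.of fun z w => inner ℂ
        (reproducing z - convIsometry hs
          ((convIsometry hs).toContinuousLinearMap.adjoint (reproducing z)))
        (reproducing w - convIsometry hs
          ((convIsometry hs).toContinuousLinearMap.adjoint (reproducing w))) :=
      Matrix.ext fun z w => schurKernel_eq hs z w
    rw [h]
    exact Matrix.posSemidef_of_inner _

/-! ### Invariant subspaces -/

section Invariant

variable {H : Submodule ℂ HardySpace}

theorem Z_pow_mem (hZ : ∀ f ∈ H, Z f ∈ H) {f : HardySpace} (hf : f ∈ H) (n : ℕ) :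
    (Z ^ n) f ∈ H := by
  induction n with
  | zero => simpa
  | succ n ih => rw [pow_succ', Module.End.mul_apply]; exact hZ _ ih

/-- `Z H` is complete, being the isometric image of a complete space, so `f` can be projected onto
it. -/
theorem exists_wandering_sub_mem (hclosed : IsClosed (H : Set HardySpace))
    (hZ : ∀ f ∈ H, Z f ∈ H) {f : HardySpace} (hf : f ∈ H) :
    ∃ w ∈ H, (∀ g ∈ H, inner ℂ w (Z g) = 0) ∧ ∃ g ∈ H, f = w + Z g := by
  have hK : IsComplete (H.map Z : Set HardySpace) :=
    (isComplete_image_iff isometryZ.isometry.isUniformInducing).2 hclosed.isComplete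
  have : CompleteSpace (H.map Z) := hK.completeSpace_coe
  obtain ⟨_, ⟨g, hg, rfl⟩, hg'⟩ :=
    Submodule.HasOrthogonalProjection.exists_orthogonal (K := H.map Z) f
  refine ⟨f - Z g, H.sub_mem hf (hZ g hg), fun k hk => ?_, g, hg, by abel⟩
  exact inner_eq_zero_symm.1 (hg' (Z k) ⟨k, hk, rfl⟩)

/-- Dividing by `Z` repeatedly moves each coefficient of `f` down to degree zero, where multiples of
`Z` vanish. -/
theorem eq_zero_of_forall_exists_Z {P : HardySpace → Prop}
    (h : ∀ f, P f → ∃ g, P g ∧ f = Z g) {f : HardySpace} (hf : P f) : f = 0 := by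
  have key : ∀ n f, P f → coeff f n = 0 := by
    intro n
    induction n with
    | zero => intro f hf; obtain ⟨g, -, rfl⟩ := h f hf; exact coeff_Z_zero g
    | succ n ih => intro f hf; obtain ⟨g, hg, rfl⟩ := h f hf; rw [coeff_Z_succ, ih g hg]
  refine ext_coeff fun n => ?_
  rw [key n f hf, ← inner_monomial, inner_zero_right]

theorem orthonormal_normalize {w : HardySpace} (hZ : ∀ f ∈ H, Z f ∈ H) (hw : w ∈ H)
    (hw' : ∀ g ∈ H, inner ℂ w (Z g) = 0) (h0 : w ≠ 0) :
    Orthonormal ℂ fun n => (Z ^ n) (((‖w‖ : ℂ)⁻¹) • w) := by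
  refine orthonormal_Z_pow (norm_smul_inv_norm h0) fun k => ?_
  rw [pow_succ', Module.End.mul_apply, inner_smul_left,
    hw' _ (Z_pow_mem hZ (H.smul_mem _ hw) k), mul_zero]

/-- Without a nonzero wandering vector every element of `H` would be `Z` of another one, forcing `H
= 0`. -/
theorem exists_orthonormal_wandering (hclosed : IsClosed (H : Set HardySpace)) (hne : H ≠ ⊥)
    (hZ : ∀ f ∈ H, Z f ∈ H) :
    ∃ s ∈ H, (∀ g ∈ H, inner ℂ s (Z g) = 0) ∧ Orthonormal ℂ fun n => (Z ^ n) s := by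
  obtain ⟨w, hw, hw', h0⟩ : ∃ w ∈ H, (∀ g ∈ H, inner ℂ w (Z g) = 0) ∧ w ≠ 0 := by
    by_contra! h
    refine hne ((Submodule.eq_bot_iff H).2 fun f hf => ?_)
    refine eq_zero_of_forall_exists_Z (P := (· ∈ H)) (fun f hf => ?_) hf
    obtain ⟨w, hw, hw', g, hg, rfl⟩ := exists_wandering_sub_mem hclosed hZ hf
    exact ⟨g, hg, by rw [h w hw hw', zero_add]⟩
  refine ⟨_, H.smul_mem _ hw, fun g hg => ?_, orthonormal_normalize hZ hw hw' h0⟩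
  rw [inner_smul_left, hw' g hg, mul_zero]

/-- The wandering subspace `H ⊖ Z H` of an invariant subspace is at most one-dimensional. -/
theorem eq_zero_of_wandering {s w : HardySpace} (hZ : ∀ f ∈ H, Z f ∈ H) (hs : s ∈ H)
    (hs' : ∀ g ∈ H, inner ℂ s (Z g) = 0) (hso : Orthonormal ℂ fun n => (Z ^ n) s) (hw : w ∈ H)
    (hw' : ∀ g ∈ H, inner ℂ w (Z g) = 0) (hsw : inner ℂ s w = 0) : w = 0 := by
  by_contra h0
  obtain ⟨m, n, hmn⟩ := exists_inner_Z_pow_ne_zero hso (orthonormal_normalize hZ hw hw' h0)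
  rw [map_smul, inner_smul_right] at hmn
  refine right_ne_zero_of_mul hmn ?_
  -- Cancelling the smaller power leaves one wandering vector against an element of `Z H`, or `s`
  -- against `w`.
  rcases lt_trichotomy m n with h | rfl | h
  · obtain ⟨k, rfl⟩ := Nat.exists_eq_add_of_lt h
    rw [add_assoc, pow_add, Module.End.mul_apply, inner_Z_pow, pow_succ', Module.End.mul_apply]
    exact hs' _ (Z_pow_mem hZ hw k)
  · rw [inner_Z_pow, hsw]
  · obtain ⟨k, rfl⟩ := Nat.exists_eq_add_of_lt h
    rw [add_assoc, pow_add, Module.End.mul_apply, inner_Z_pow, pow_succ', Module.End.mul_apply]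
    exact inner_eq_zero_symm.1 (hw' _ (Z_pow_mem hZ hs k))

theorem range_convIsometry (hclosed : IsClosed (H : Set HardySpace)) (hZ : ∀ f ∈ H, Z f ∈ H)
    {s : HardySpace} (hs : s ∈ H) (hs' : ∀ g ∈ H, inner ℂ s (Z g) = 0)
    (hso : Orthonormal ℂ fun n => (Z ^ n) s) :
    LinearMap.range (convIsometry hso).toLinearMap = H := by
  have hle : ∀ f, convIsometry hso f ∈ H := fun f =>
    hclosed.mem_of_tendsto (hasSum_convIsometry hso f)
      (Filter.Eventually.of_forall fun t =>
        H.sum_mem fun n _ => H.smul_mem _ (Z_pow_mem hZ hs n))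
  refine le_antisymm ?_ fun f hf => ?_
  · rintro _ ⟨f, rfl⟩
    exact hle f
  refine ⟨(convIsometry hso).toContinuousLinearMap.adjoint f, Eq.symm (sub_eq_zero.1 ?_)⟩
  -- The residual lies in the part of `H` orthogonal to the orbit of `s`. Any such `g` is `w + Z k`
  -- with `w` wandering and orthogonal to `s`, so `w = 0`, and `k` is again of this kind because `Z`
  -- is isometric.
  refine eq_zero_of_forall_exists_Z
    (P := fun g => g ∈ H ∧ ∀ n, inner ℂ ((Z ^ n) s) g = 0) ?_ ⟨H.sub_mem hf (hle _), fun n => ?_⟩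
  · rintro g ⟨hg, hg'⟩
    obtain ⟨w, hw, hw', k, hk, rfl⟩ := exists_wandering_sub_mem hclosed hZ hg
    have hsw : inner ℂ s w = 0 := by
      simpa [inner_add_right, hs' k hk] using hg' 0
    obtain rfl := eq_zero_of_wandering hZ hs hs' hso hw hw' hsw
    refine ⟨k, ⟨hk, fun n => ?_⟩, zero_add _⟩
    have := hg' (n + 1)
    rwa [zero_add, pow_succ', Module.End.mul_apply, inner_Z] at this
  · rw [← convIsometry_monomial hso]
    exact (convIsometry hso).inner_map_sub_adjoint _ _

end Invariant

/-- A convolution operator on the Hardy space commutes with `Z`. -/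
theorem Z_map_of_isConvolution {s : HalfLattice → ℂ} {M : HardySpace → HardySpace}
    (hM : ∀ f : HardySpace, IsConvolution s f (M f)) (f : HardySpace) : M (Z f) = Z (M f) := by
  refine ext_coeff fun n => ?_
  rw [(hM _).coeff_eq]
  cases n with
  | zero => simp [coeff_Z_zero]
  | succ n =>
    rw [coeff_Z_succ, (hM _).coeff_eq]
    beta_reduce
    -- The term `m = n + 1` carries the constant coefficient of `Z f`, which is zero.
    rw [Finset.sum_range_succ, Nat.sub_self, coeff_Z_zero, mul_zero,
      add_zero]
    refine Finset.sum_congr rfl fun m hm => ?_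
    rw [Nat.succ_sub (Nat.lt_succ_iff.1 (Finset.mem_range.1 hm)), coeff_Z_succ]

end HardySpace

end

end DiscreteAnalytic

theorem theorem5p4
    (H : Submodule ℂ DiscreteAnalytic.HardySpace)
    (hclosed : IsClosed (H : Set DiscreteAnalytic.HardySpace))
    (hne : H ≠ ⊥) :
    (∀ f ∈ H, DiscreteAnalytic.HardySpace.Z f ∈ H) ↔
      ∃ s : DiscreteAnalytic.HalfLattice → ℂ, DiscreteAnalytic.IsSchurFunction s ∧
        ∃ M : DiscreteAnalytic.HardySpace →ₗᵢ[ℂ] DiscreteAnalytic.HardySpace,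
          (∀ f : DiscreteAnalytic.HardySpace, DiscreteAnalytic.IsConvolution s f (M f)) ∧
          LinearMap.range M.toLinearMap = H := by
  open DiscreteAnalytic.HardySpace in
  constructor
  · intro hZ
    obtain ⟨s, hs, hs', hso⟩ := exists_orthonormal_wandering hclosed hne hZ
    exact ⟨s, isSchurFunction hso, convIsometry hso, isConvolution_convIsometry hso,
      range_convIsometry hclosed hZ hs hs' hso⟩
  · rintro ⟨s, -, M, hM, rfl⟩ _ ⟨f, rfl⟩
    exact ⟨Z f, Z_map_of_isConvolution hM f⟩
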